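/- First-order sentences about graphs are built from atomic formulas $x\sim y$ (adjacency) and $x=y$ by means of $\neg,\wedge,\vee,\exists,\forall$ (no logical constants for truth and falsity, so every sentence contains a quantifier). The quantifier depth of a sentence is the maximum number of nested quantifiers in it; its variable width is the number of distinct variables used in it, where a variable may be quantified repeatedly. All graphs are finite and simple. For a connected graph $F$, let $v(F)$ be its number of vertices. Say that a sentence $\Phi$ defines the existence of an $F$-subgraph on sufficiently large connected graphs if there is a $k$ such that, for every connected graph $G$ with at least $k$ vertices, $\Phi$ is true on $G$ if and only if $G$ contains a (not necessarily induced) subgraph isomorphic to $F$. Let $D_v(F)$ and $W_v(F)$ be, respectively, the minimum quantifier depth and the minimum variable width of such a sentence $\Phi$. Theorem 3.4. Let $F$ be a connected graph that is isomorphic neither to the path $P_2$ on 2 vertices nor to the path $P_3$ on 3 vertices. Then $$D_v(F)\ge\frac{v(F)+1}{2}\qquad\text{and}\qquad W_v(F)\ge\frac{v(F)-1}{2}.$$ -/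

import Mathlib

/-- First-order formulas in the language of graphs (adjacency and equality) over the variables
`x₀, x₁, x₂, …`, where variables may be re-quantified. There are no logical constants for
truth and falsity, so every sentence contains a quantifier. -/
inductive GraphFormula : Type
  | adj (i j : ℕ) : GraphFormula
  | equal (i j : ℕ) : GraphFormula
  | neg (φ : GraphFormula) : GraphFormula
  | conj (φ ψ : GraphFormula) : GraphFormula
  | disj (φ ψ : GraphFormula) : GraphFormula
  | ex (i : ℕ) (φ : GraphFormula) : GraphFormula
  | all (i : ℕ) (φ : GraphFormula) : GraphFormula

namespace GraphFormula

/-- Satisfaction of a formula in the graph `G` under the assignment `s` of the variables. -/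
def Realize {V : Type*} (G : SimpleGraph V) : GraphFormula → (ℕ → V) → Prop
  | adj i j, s => G.Adj (s i) (s j)
  | equal i j, s => s i = s j
  | neg φ, s => ¬ Realize G φ s
  | conj φ ψ, s => Realize G φ s ∧ Realize G ψ s
  | disj φ ψ, s => Realize G φ s ∨ Realize G ψ s
  | ex i φ, s => ∃ a : V, Realize G φ (Function.update s i a)
  | all i φ, s => ∀ a : V, Realize G φ (Function.update s i a)

/-- The set of free variables. -/
def freeVars : GraphFormula → Finset ℕ
  | adj i j => {i, j}
  | equal i j => {i, j}
  | neg φ => freeVars φ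
  | conj φ ψ => freeVars φ ∪ freeVars ψ
  | disj φ ψ => freeVars φ ∪ freeVars ψ
  | ex i φ => (freeVars φ).erase i
  | all i φ => (freeVars φ).erase i

/-- A sentence is a formula without free variables. -/
def IsSentence (φ : GraphFormula) : Prop := φ.freeVars = ∅

/-- The set of all variables used to build the formula. -/
def vars : GraphFormula → Finset ℕ
  | adj i j => {i, j}
  | equal i j => {i, j}
  | neg φ => vars φ
  | conj φ ψ => vars φ ∪ vars ψ
  | disj φ ψ => vars φ ∪ vars ψ
  | ex i φ => insert i (vars φ)
  | all i φ => insert i (vars φ)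

/-- The variable width: the number of distinct variables used. -/
def width (φ : GraphFormula) : ℕ := φ.vars.card

/-- The quantifier depth: the maximum number of nested quantifiers. -/
def depth : GraphFormula → ℕ
  | adj _ _ => 0
  | equal _ _ => 0
  | neg φ => depth φ
  | conj φ ψ => max (depth φ) (depth ψ)
  | disj φ ψ => max (depth φ) (depth ψ)
  | ex _ φ => depth φ + 1
  | all _ φ => depth φ + 1

/-- A sentence is true on `G` if it is satisfied under every assignment (for a sentence and a
nonempty graph, equivalently under some assignment). -/
def TrueOn {V : Type*} (φ : GraphFormula) (G : SimpleGraph V) : Prop :=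
  ∀ s : ℕ → V, φ.Realize G s

/-- The sentence `φ` is true on a connected finite graph `G` with at least `k` vertices exactly
when `G` contains a (not necessarily induced) subgraph isomorphic to `F`. -/
def DefinesSubgraphFrom {U : Type*} (φ : GraphFormula) (F : SimpleGraph U) (k : ℕ) : Prop :=
  φ.IsSentence ∧
    ∀ (V : Type) [Fintype V] (G : SimpleGraph V), G.Connected → k ≤ Fintype.card V →
      (φ.TrueOn G ↔ F.IsContained G)

/-- The sentence `φ` defines the existence of an `F`-subgraph on sufficiently large connected
graphs. -/
def DefinesSubgraph {U : Type*} (φ : GraphFormula) (F : SimpleGraph U) : Prop :=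
  ∃ k : ℕ, φ.DefinesSubgraphFrom F k

end GraphFormula

/-- `D_v(F)`: the minimum quantifier depth of a sentence that defines the existence of an
`F`-subgraph on sufficiently large connected graphs. -/
noncomputable def subgraphDepth {U : Type*} (F : SimpleGraph U) : ℕ :=
  sInf {d : ℕ | ∃ φ : GraphFormula, φ.DefinesSubgraph F ∧ φ.depth = d}

/-- `W_v(F)`: the minimum variable width of a sentence that defines the existence of an
`F`-subgraph on sufficiently large connected graphs. -/
noncomputable def subgraphWidth {U : Type*} (F : SimpleGraph U) : ℕ :=
  sInf {w : ℕ | ∃ φ : GraphFormula, φ.DefinesSubgraph F ∧ φ.width = w}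

namespace GraphFormula

theorem realize_foldr_conj {V : Type*} (G : SimpleGraph V) (s : ℕ → V) (l : List GraphFormula)
    (φ : GraphFormula) :
    (l.foldr conj φ).Realize G s ↔ (∀ ψ ∈ l, ψ.Realize G s) ∧ φ.Realize G s := by
  induction l with
  | nil => simp
  | cons a l ih => simp [Realize, ih, and_assoc]

theorem freeVars_foldr_conj (A : Finset ℕ) (l : List GraphFormula) (φ : GraphFormula)
    (h : ∀ ψ ∈ l, ψ.freeVars ⊆ A) (h' : φ.freeVars ⊆ A) :
    (l.foldr conj φ).freeVars ⊆ A := by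
  induction l with
  | nil => simpa using h'
  | cons a l ih =>
    simp only [List.foldr_cons, freeVars]
    exact Finset.union_subset (h a (by simp)) (ih fun ψ hψ => h ψ (by simp [hψ]))

theorem realize_foldr_ex {V : Type*} (G : SimpleGraph V) (l : List ℕ) (φ : GraphFormula)
    (s : ℕ → V) :
    (l.foldr ex φ).Realize G s ↔ ∃ s' : ℕ → V, (∀ i, i ∉ l → s' i = s i) ∧ φ.Realize G s' := by
  induction l generalizing s with
  | nil =>
    constructor
    · intro h
      exact ⟨s, by simp, h⟩
    · rintro ⟨s', h, h'⟩
      have : s' = s := funext fun i => h i (by simp)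
      simpa [this] using h'
  | cons a l ih =>
    simp only [List.foldr_cons, Realize, ih]
    constructor
    · rintro ⟨v, s', h, h'⟩
      refine ⟨s', fun i hi => ?_, h'⟩
      simp only [List.mem_cons, not_or] at hi
      rw [h i hi.2, Function.update_of_ne hi.1]
    · rintro ⟨s', h, h'⟩
      refine ⟨s' a, s', fun i hi => ?_, h'⟩
      by_cases hia : i = a
      · simp [hia]
      · rw [Function.update_of_ne hia]
        exact h i (by simp [hia, hi])

theorem freeVars_foldr_ex (l : List ℕ) (φ : GraphFormula) :
    (l.foldr ex φ).freeVars = φ.freeVars \ l.toFinset := by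
  induction l with
  | nil => simp
  | cons a l ih =>
    ext i
    simp only [List.foldr_cons, freeVars, ih]
    simp
    tauto

open Classical in
/-- A defining sentence exists, so the two minima above are taken over nonempty sets. -/
theorem exists_definesSubgraph {U : Type*} [Fintype U] [Nonempty U] (F : SimpleGraph U) :
    ∃ φ : GraphFormula, φ.DefinesSubgraph F := by
  let f : U → ℕ := fun u => (Fintype.equivFin U u : ℕ)
  have hf : Function.Injective f := fun a b h =>
    (Fintype.equivFin U).injective (Fin.ext h)
  let u0 : U := Classical.arbitrary U
  let g : U × U → GraphFormula := fun p =>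
    if p.1 = p.2 then equal (f p.1) (f p.2)
    else if F.Adj p.1 p.2 then conj (neg (equal (f p.1) (f p.2))) (adj (f p.1) (f p.2))
    else neg (equal (f p.1) (f p.2))
  let l : List ℕ := (Finset.univ.image f).toList
  let L : List GraphFormula := (Finset.univ : Finset (U × U)).toList.map g
  have hl : ∀ u, f u ∈ l := fun u => by simp [l]
  refine ⟨l.foldr ex (L.foldr conj (equal (f u0) (f u0))), 0, ?_, ?_⟩
  · rw [IsSentence, freeVars_foldr_ex, Finset.sdiff_eq_empty_iff_subset]
    apply freeVars_foldr_conj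
    · intro ψ hψ
      obtain ⟨p, -, rfl⟩ := List.mem_map.1 hψ
      simp only [g]
      split_ifs <;> intro i hi <;> simp [freeVars] at hi <;>
        rcases hi with rfl | rfl <;> simp [hl]
    · intro i hi
      simp only [freeVars, Finset.mem_insert, Finset.mem_singleton, or_self] at hi
      simp [hi, hl]
  · intro V _ G hG _
    have key : ∀ s : ℕ → V, (L.foldr conj (equal (f u0) (f u0))).Realize G s ↔
        (∀ a b : U, a ≠ b → s (f a) ≠ s (f b)) ∧ ∀ a b : U, F.Adj a b →
          G.Adj (s (f a)) (s (f b)) := by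
      intro s
      rw [realize_foldr_conj]
      constructor
      · rintro ⟨h, -⟩
        have h2 : ∀ a b : U, (g (a, b)).Realize G s := fun a b =>
          h _ (List.mem_map.2 ⟨(a, b), by simp, rfl⟩)
        refine ⟨fun a b hab => ?_, fun a b hab => ?_⟩
        · have := h2 a b
          simp only [g, if_neg hab] at this
          split_ifs at this
          · exact this.1
          · exact this
        · have := h2 a b
          simp only [g, if_neg hab.ne, if_pos hab] at this
          exact this.2
      · rintro ⟨h, h2⟩
        refine ⟨fun ψ hψ => ?_, rfl⟩
        obtain ⟨⟨a, b⟩, -, rfl⟩ := List.mem_map.1 hψ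
        simp only [g]
        split_ifs with hab hadj
        · simp [Realize, hab]
        · exact ⟨h a b hab, h2 a b hadj⟩
        · exact h a b hab
    constructor
    · intro h
      obtain ⟨v⟩ := hG.nonempty
      obtain ⟨s, -, hs⟩ := (realize_foldr_ex G l _ _).1 (h fun _ => v)
      rw [key] at hs
      refine ⟨⟨⟨fun a => s (f a), fun {a b} hab => hs.2 a b hab⟩, fun a b hab => ?_⟩⟩
      by_contra hne
      exact hs.1 a b hne hab
    · rintro ⟨c⟩ s
      rw [realize_foldr_ex]
      refine ⟨fun i => if h : ∃ a, f a = i then c h.choose else s i, fun i hi => ?_, ?_⟩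
      · have hn : ¬ ∃ a, f a = i := fun ⟨a, ha⟩ => hi (ha ▸ hl a)
        simp [hn]
      · have hc : ∀ a, (fun i => if h : ∃ a, f a = i then c h.choose else s i) (f a) = c a := by
          intro a
          have hx : ∃ b, f b = f a := ⟨a, rfl⟩
          simp only [hx, dif_pos]
          rw [hf hx.choose_spec]
        rw [key]
        simp only [hc]
        exact ⟨fun a b hab h => hab (c.injective h), fun a b hab => c.toHom.map_adj hab⟩

end GraphFormula

/-!
Let `F` be connected with `ℓ ≥ 3` vertices. For a rooted graph `T` let `cliqueGlue k T r` be `T`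
together with a clique of size `k + 1` through its root `r`. The `k` clique vertices other than `r`
are twins, so in the Ehrenfeucht game the graphs `cliqueGlue (k + 1) T r` and `cliqueGlue k T r`
can only be told apart by exhausting twins. This takes more than `k` pebbles, and more than `k + 1`
rounds, because in the very last round the root can still stand in for one more twin
(`GraphFormula.trueOn_cliqueGlue_succ_iff`). Hence, if `F` embeds in `cliqueGlue (k + 1) T r` but
not in `cliqueGlue k T r` for arbitrarily large connected `T`, every sentence that defines the
existence of `F` has depth at least `k + 2` and width at least `k + 1`.

It remains to choose `T` so that `F` only embeds in `cliqueGlue k T r` if `2 * k + 1 ≥ ℓ`. Either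
the stars rooted at their centre or the paths rooted at an end will do: if `F` embedded with smaller
`k` in both families, then at least half of the vertices of `F` would be leaves attached to one
vertex `v`, and at least half of them would lie on a path that is attached to the rest of `F` by
one end. Counting, either a leaf at `v` lies on the path, which then has just one vertex, or `v`
lies on it and has degree at most two. Both force `F` to be the path on three vertices
(`nonempty_iso_pathGraph_three`).
-/

open SimpleGraph

/-! ### Rooted graphs with a clique at the root -/

/-- The graph `T` with `k` new vertices, adjacent to each other and to the vertex `r` of `T`. Thus
`r` and the new vertices form a clique of size `k + 1`, and the new vertices are twins. -/
def cliqueGlue {B : Type*} (k : ℕ) (T : SimpleGraph B) (r : B) : SimpleGraph (Fin k ⊕ B) where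
  Adj
    | .inl i, .inl j => i ≠ j
    | .inl _, .inr b => b = r
    | .inr b, .inl _ => b = r
    | .inr b, .inr c => T.Adj b c
  symm := ⟨by
    rintro (i | b) (j | c) h
    · exact Ne.symm h
    · exact h
    · exact h
    · exact Adj.symm h⟩
  loopless := ⟨by
    rintro (i | b) h
    · exact h rfl
    · exact T.irrefl h⟩

section cliqueGlue

variable {B : Type*} {k : ℕ} {T : SimpleGraph B} {r : B}

@[simp] theorem cliqueGlue_adj_inl_inl {i j : Fin k} :
    (cliqueGlue k T r).Adj (.inl i) (.inl j) ↔ i ≠ j := Iff.rfl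

@[simp] theorem cliqueGlue_adj_inl_inr {i : Fin k} {b : B} :
    (cliqueGlue k T r).Adj (.inl i) (.inr b) ↔ b = r := Iff.rfl

@[simp] theorem cliqueGlue_adj_inr_inl {i : Fin k} {b : B} :
    (cliqueGlue k T r).Adj (.inr b) (.inl i) ↔ b = r := Iff.rfl

@[simp] theorem cliqueGlue_adj_inr_inr {b c : B} :
    (cliqueGlue k T r).Adj (.inr b) (.inr c) ↔ T.Adj b c := Iff.rfl

theorem cliqueGlue_connected (hT : T.Connected) : (cliqueGlue k T r).Connected := by
  let f : T →g cliqueGlue k T r := ⟨Sum.inr, fun h => h⟩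
  have h : ∀ x, (cliqueGlue k T r).Reachable x (.inr r) := by
    rintro (i | b)
    · exact Adj.reachable (G := cliqueGlue k T r) (u := .inl i) (v := .inr r) rfl
    · exact (hT.preconnected b r).map f
  have : Nonempty (Fin k ⊕ B) := ⟨.inr r⟩
  exact ⟨fun x y => (h x).trans (h y).symm⟩

theorem isContained_cliqueGlue_card {U : Type*} [Fintype U] (F : SimpleGraph U)
    (T : SimpleGraph B) (r : B) : F.IsContained (cliqueGlue (Fintype.card U) T r) :=
  ⟨⟨⟨fun u => .inl (Fintype.equivFin U u), fun {u v} h => by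
    rw [cliqueGlue_adj_inl_inl]
    exact fun h' => h.ne ((Fintype.equivFin U).injective h')⟩,
    fun u v h => (Fintype.equivFin U).injective (Sum.inl_injective h)⟩⟩

end cliqueGlue

/-! ### The Ehrenfeucht game on graphs with a clique at the root -/

namespace GraphFormula

/-- On the variables in `Y`, the assignments `s` and `t` define a partial isomorphism. -/
structure PartialIso {V W : Type*} (G : SimpleGraph V) (H : SimpleGraph W) (Y : Finset ℕ)
    (s : ℕ → V) (t : ℕ → W) : Prop where
  eq_iff : ∀ i ∈ Y, ∀ j ∈ Y, (s i = s j ↔ t i = t j)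
  adj_iff : ∀ i ∈ Y, ∀ j ∈ Y, (G.Adj (s i) (s j) ↔ H.Adj (t i) (t j))

/-- The variables in `Y` have the same equalities under `s` and `t` and agree whenever one of the
values lies in the common part `B`; so they define a partial isomorphism between any `cliqueGlue k`
and `cliqueGlue l` over `B` which fixes `B`. -/
structure SameType {B : Type*} {k l : ℕ} (Y : Finset ℕ) (s : ℕ → Fin k ⊕ B)
    (t : ℕ → Fin l ⊕ B) : Prop where
  eq_iff : ∀ i ∈ Y, ∀ j ∈ Y, (s i = s j ↔ t i = t j)
  inr_iff : ∀ i ∈ Y, ∀ b, (s i = .inr b ↔ t i = .inr b)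

theorem PartialIso.mono {V W : Type*} {G : SimpleGraph V} {H : SimpleGraph W} {X Y : Finset ℕ}
    {s : ℕ → V} {t : ℕ → W} (h : PartialIso G H Y s t) (hXY : X ⊆ Y) : PartialIso G H X s t :=
  ⟨fun i hi j hj => h.eq_iff i (hXY hi) j (hXY hj),
    fun i hi j hj => h.adj_iff i (hXY hi) j (hXY hj)⟩

theorem PartialIso.update {V W : Type*} {G : SimpleGraph V} {H : SimpleGraph W} {X : Finset ℕ}
    {i : ℕ} {s : ℕ → V} {t : ℕ → W} (h : PartialIso G H (X.erase i) s t) {a : V} {b : W}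
    (heq : ∀ j ∈ X.erase i, (a = s j ↔ b = t j))
    (hadj : ∀ j ∈ X.erase i, (G.Adj a (s j) ↔ H.Adj b (t j))) :
    PartialIso G H X (Function.update s i a) (Function.update t i b) := by
  constructor
  · intro x hx y hy
    by_cases hxi : x = i <;> by_cases hyi : y = i
    · simp [hxi, hyi]
    · subst hxi
      simpa [hyi] using heq y (Finset.mem_erase.2 ⟨hyi, hy⟩)
    · subst hyi
      simpa [hxi, eq_comm] using heq x (Finset.mem_erase.2 ⟨hxi, hx⟩)
    · simpa [hxi, hyi] using
        h.eq_iff x (Finset.mem_erase.2 ⟨hxi, hx⟩) y (Finset.mem_erase.2 ⟨hyi, hy⟩)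
  · intro x hx y hy
    by_cases hxi : x = i <;> by_cases hyi : y = i
    · simp [hxi, hyi]
    · subst hxi
      simpa [hyi] using hadj y (Finset.mem_erase.2 ⟨hyi, hy⟩)
    · subst hyi
      simpa [hxi, adj_comm] using hadj x (Finset.mem_erase.2 ⟨hxi, hx⟩)
    · simpa [hxi, hyi] using
        h.adj_iff x (Finset.mem_erase.2 ⟨hxi, hx⟩) y (Finset.mem_erase.2 ⟨hyi, hy⟩)

theorem realize_iff_of_depth_eq_zero {V W : Type*} {G : SimpleGraph V} {H : SimpleGraph W}
    {s : ℕ → V} {t : ℕ → W} (φ : GraphFormula) (hφ : φ.depth = 0)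
    (h : PartialIso G H φ.freeVars s t) : φ.Realize G s ↔ φ.Realize H t := by
  induction φ with
  | adj i j => exact h.adj_iff i (by simp [freeVars]) j (by simp [freeVars])
  | equal i j => exact h.eq_iff i (by simp [freeVars]) j (by simp [freeVars])
  | neg φ ih => exact not_congr (ih hφ h)
  | conj φ ψ ih ih' =>
    simp only [depth, Nat.max_eq_zero_iff] at hφ
    exact and_congr (ih hφ.1 (h.mono Finset.subset_union_left))
      (ih' hφ.2 (h.mono Finset.subset_union_right))
  | disj φ ψ ih ih' =>
    simp only [depth, Nat.max_eq_zero_iff] at hφ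
    exact or_congr (ih hφ.1 (h.mono Finset.subset_union_left))
      (ih' hφ.2 (h.mono Finset.subset_union_right))
  | ex i φ => simp [depth] at hφ
  | all i φ => simp [depth] at hφ

section SameType

variable {B : Type*} {k l : ℕ} {X Y : Finset ℕ} {s : ℕ → Fin k ⊕ B} {t : ℕ → Fin l ⊕ B}

theorem SameType.symm (h : SameType Y s t) : SameType Y t s :=
  ⟨fun i hi j hj => (h.eq_iff i hi j hj).symm, fun i hi b => (h.inr_iff i hi b).symm⟩

theorem SameType.mono (h : SameType Y s t) (hXY : X ⊆ Y) : SameType X s t :=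
  ⟨fun i hi j hj => h.eq_iff i (hXY hi) j (hXY hj), fun i hi => h.inr_iff i (hXY hi)⟩

theorem SameType.partialIso (h : SameType Y s t) (T : SimpleGraph B) (r : B) :
    PartialIso (cliqueGlue k T r) (cliqueGlue l T r) Y s t := by
  refine ⟨h.eq_iff, fun i hi j hj => ?_⟩
  have hi' := h.inr_iff i hi
  have hj' := h.inr_iff j hj
  have hij := h.eq_iff i hi j hj
  rcases hsi : s i with x | b <;> rcases hti : t i with x' | b' <;>
    rcases hsj : s j with y | c <;> rcases htj : t j with y' | c' <;> simp_all

theorem SameType.update {i : ℕ} (h : SameType (X.erase i) s t) {a : Fin k ⊕ B} {b : Fin l ⊕ B}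
    (heq : ∀ j ∈ X.erase i, (a = s j ↔ b = t j)) (hinr : ∀ c, (a = .inr c ↔ b = .inr c)) :
    SameType X (Function.update s i a) (Function.update t i b) := by
  constructor
  · intro x hx y hy
    by_cases hxi : x = i <;> by_cases hyi : y = i
    · simp [hxi, hyi]
    · subst hxi
      simpa [hyi] using heq y (Finset.mem_erase.2 ⟨hyi, hy⟩)
    · subst hyi
      simpa [hxi, eq_comm] using heq x (Finset.mem_erase.2 ⟨hxi, hx⟩)
    · simpa [hxi, hyi] using
        h.eq_iff x (Finset.mem_erase.2 ⟨hxi, hx⟩) y (Finset.mem_erase.2 ⟨hyi, hy⟩)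
  · intro x hx c
    by_cases hxi : x = i
    · subst hxi
      simpa using hinr c
    · simpa [hxi] using h.inr_iff x (Finset.mem_erase.2 ⟨hxi, hx⟩) c

/-- Duplicator can answer any move as long as an unused twin is left. -/
theorem SameType.exists_response_of_unused (h : SameType Y s t)
    (hj : ∃ j : Fin l, ∀ y ∈ Y, t y ≠ .inl j) (a : Fin k ⊕ B) :
    ∃ b : Fin l ⊕ B, (∀ j ∈ Y, (a = s j ↔ b = t j)) ∧ ∀ c, (a = .inr c ↔ b = .inr c) := by
  rcases a with x | c
  · by_cases hx : ∃ y ∈ Y, s y = .inl x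
    · obtain ⟨y, hy, hyx⟩ := hx
      rw [← hyx]
      exact ⟨t y, h.eq_iff y hy, h.inr_iff y hy⟩
    · obtain ⟨j, hj⟩ := hj
      push Not at hx
      refine ⟨.inl j, fun y hy => ?_, by simp⟩
      exact iff_of_false (fun e => hx y hy e.symm) (fun e => hj y hy e.symm)
  · refine ⟨.inr c, fun y hy => ?_, by simp⟩
    rw [eq_comm, h.inr_iff y hy c, eq_comm]

theorem exists_unused_of_card_lt (t : ℕ → Fin l ⊕ B) (hY : Y.card < l) :
    ∃ j : Fin l, ∀ y ∈ Y, t y ≠ .inl j := by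
  classical
  by_contra! h
  have hsub : Finset.univ.image (Sum.inl : Fin l → Fin l ⊕ B) ⊆ Y.image t := by
    intro z hz
    obtain ⟨j, -, rfl⟩ := Finset.mem_image.1 hz
    obtain ⟨y, hy, e⟩ := h j
    exact Finset.mem_image.2 ⟨y, hy, e⟩
  have := (Finset.card_le_card hsub).trans Finset.card_image_le
  rw [Finset.card_image_of_injective _ Sum.inl_injective, Finset.card_fin] at this
  omega

/-- If at most as many pebbles as twins were placed, Duplicator can make one more move that keeps
a partial isomorphism: when all twins are used, the root answers as a further twin. -/
theorem SameType.exists_response_of_card_le (h : SameType Y s t) (hY : Y.card ≤ l)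
    (T : SimpleGraph B) (r : B) (a : Fin k ⊕ B) :
    ∃ b : Fin l ⊕ B, (∀ j ∈ Y, (a = s j ↔ b = t j)) ∧
      ∀ j ∈ Y, ((cliqueGlue k T r).Adj a (s j) ↔ (cliqueGlue l T r).Adj b (t j)) := by
  classical
  by_cases hj : ∃ j : Fin l, ∀ y ∈ Y, t y ≠ .inl j
  · obtain ⟨b, hb, hb'⟩ := h.exists_response_of_unused hj a
    refine ⟨b, hb, fun j hj => ?_⟩
    have h1 := hb j hj
    have h2 := h.inr_iff j hj
    rcases a with x | c <;> rcases b with x' | c' <;> rcases hsj : s j with y | d <;>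
      rcases htj : t j with y' | d' <;> simp_all
  push Not at hj
  -- The used twins exhaust the values of `t`, so no value of `s` or `t` lies in `B`.
  have hsub : Finset.univ.image (Sum.inl : Fin l → Fin l ⊕ B) ⊆ Y.image t := by
    intro z hz
    obtain ⟨j, -, rfl⟩ := Finset.mem_image.1 hz
    obtain ⟨y, hy, e⟩ := hj j
    exact Finset.mem_image.2 ⟨y, hy, e⟩
  have hcard : (Y.image t).card ≤ (Finset.univ.image (Sum.inl : Fin l → Fin l ⊕ B)).card := by
    rw [Finset.card_image_of_injective _ Sum.inl_injective, Finset.card_fin]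
    exact Finset.card_image_le.trans hY
  have himg := Finset.eq_of_subset_of_card_le hsub hcard
  have ht : ∀ y ∈ Y, ∃ j, t y = .inl j := by
    intro y hy
    have := Finset.mem_image_of_mem t hy
    rw [← himg] at this
    obtain ⟨j, -, e⟩ := Finset.mem_image.1 this
    exact ⟨j, e.symm⟩
  have hs : ∀ y ∈ Y, ∃ j, s y = .inl j := by
    intro y hy
    obtain ⟨j, e⟩ := ht y hy
    rcases hsy : s y with x | c
    · exact ⟨x, rfl⟩
    · rw [h.inr_iff y hy c, e] at hsy
      simp at hsy
  rcases a with x | c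
  · by_cases hx : ∃ y ∈ Y, s y = .inl x
    · obtain ⟨y, hy, e⟩ := hx
      rw [← e]
      exact ⟨t y, h.eq_iff y hy, (h.partialIso T r).adj_iff y hy⟩
    · push Not at hx
      refine ⟨.inr r, fun y hy => ?_, fun y hy => ?_⟩ <;> obtain ⟨j, e⟩ := ht y hy <;>
        obtain ⟨j', e'⟩ := hs y hy <;> have := hx y hy <;> simp_all [eq_comm]
  · refine ⟨.inr c, fun y hy => ?_, fun y hy => ?_⟩ <;> obtain ⟨j, e⟩ := ht y hy <;>
      obtain ⟨j', e'⟩ := hs y hy <;> simp [e, e']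

end SameType

/-- A syntactic bound which guarantees that Duplicator survives the game given by `φ` on
`cliqueGlue (k + 1) T r` and `cliqueGlue k T r`: at every quantifier fewer than `k` pebbles lie on
the board, or at most `k` if no further quantifier follows. -/
def PebbleBound (k : ℕ) : GraphFormula → Prop
  | adj _ _ => True
  | equal _ _ => True
  | neg φ => PebbleBound k φ
  | conj φ ψ => PebbleBound k φ ∧ PebbleBound k ψ
  | disj φ ψ => PebbleBound k φ ∧ PebbleBound k ψ
  | ex i φ => PebbleBound k φ ∧ ((φ.freeVars.erase i).card < k ∨
      φ.depth = 0 ∧ (φ.freeVars.erase i).card ≤ k)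
  | all i φ => PebbleBound k φ ∧ ((φ.freeVars.erase i).card < k ∨
      φ.depth = 0 ∧ (φ.freeVars.erase i).card ≤ k)

theorem freeVars_subset_vars (φ : GraphFormula) : φ.freeVars ⊆ φ.vars := by
  induction φ with
  | adj i j => exact subset_rfl
  | equal i j => exact subset_rfl
  | neg φ ih => exact ih
  | conj φ ψ ih ih' => exact Finset.union_subset_union ih ih'
  | disj φ ψ ih ih' => exact Finset.union_subset_union ih ih'
  | ex i φ ih => exact (Finset.erase_subset _ _).trans (ih.trans (Finset.subset_insert _ _))
  | all i φ ih => exact (Finset.erase_subset _ _).trans (ih.trans (Finset.subset_insert _ _))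

theorem card_erase_freeVars_lt {φ : GraphFormula} {i k : ℕ} (h : (insert i φ.vars).card ≤ k) :
    (φ.freeVars.erase i).card < k := by
  have hi : i ∉ φ.freeVars.erase i := Finset.notMem_erase i _
  have := Finset.card_le_card (Finset.insert_subset_insert i
    ((Finset.erase_subset i _).trans φ.freeVars_subset_vars))
  rw [Finset.card_insert_of_notMem hi] at this
  omega

theorem pebbleBound_of_width_le {k : ℕ} (φ : GraphFormula) (h : φ.width ≤ k) :
    φ.PebbleBound k := by
  induction φ with
  | adj i j => trivial
  | equal i j => trivial
  | neg φ ih => exact ih h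
  | conj φ ψ ih ih' | disj φ ψ ih ih' =>
    exact ⟨ih ((Finset.card_le_card Finset.subset_union_left).trans h),
      ih' ((Finset.card_le_card Finset.subset_union_right).trans h)⟩
  | ex i φ ih | all i φ ih =>
    exact ⟨ih ((Finset.card_le_card (Finset.subset_insert _ _)).trans h),
      .inl (card_erase_freeVars_lt h)⟩

theorem pebbleBound_of_depth_le {k : ℕ} (φ : GraphFormula)
    (h : φ.freeVars.card + φ.depth ≤ k + 1) : φ.PebbleBound k := by
  induction φ with
  | adj i j => trivial
  | equal i j => trivial
  | neg φ ih => exact ih h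
  | conj φ ψ ih ih' | disj φ ψ ih ih' =>
    simp only [freeVars, depth] at h
    have h1 : φ.freeVars.card ≤ (φ.freeVars ∪ ψ.freeVars).card :=
      Finset.card_le_card Finset.subset_union_left
    have h2 : ψ.freeVars.card ≤ (φ.freeVars ∪ ψ.freeVars).card :=
      Finset.card_le_card Finset.subset_union_right
    exact ⟨ih (by omega), ih' (by omega)⟩
  | ex i φ ih | all i φ ih =>
    simp only [freeVars, depth] at h
    have := Finset.pred_card_le_card_erase (s := φ.freeVars) (a := i)
    exact ⟨ih (by omega), by omega⟩

theorem realize_cliqueGlue_succ_iff {B : Type*} {k : ℕ} (T : SimpleGraph B) (r : B)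
    (φ : GraphFormula) (hφ : φ.PebbleBound k) (s : ℕ → Fin (k + 1) ⊕ B) (t : ℕ → Fin k ⊕ B)
    (h : SameType φ.freeVars s t) :
    φ.Realize (cliqueGlue (k + 1) T r) s ↔ φ.Realize (cliqueGlue k T r) t := by
  induction φ generalizing s t with
  | adj i j => exact realize_iff_of_depth_eq_zero (adj i j) rfl (h.partialIso T r)
  | equal i j => exact realize_iff_of_depth_eq_zero (equal i j) rfl (h.partialIso T r)
  | neg φ ih => exact not_congr (ih hφ s t h)
  | conj φ ψ ih ih' =>
    exact and_congr (ih hφ.1 s t (h.mono Finset.subset_union_left))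
      (ih' hφ.2 s t (h.mono Finset.subset_union_right))
  | disj φ ψ ih ih' =>
    exact or_congr (ih hφ.1 s t (h.mono Finset.subset_union_left))
      (ih' hφ.2 s t (h.mono Finset.subset_union_right))
  | ex i φ ih | all i φ ih =>
    have forth : ∀ a, ∃ b, (φ.Realize (cliqueGlue (k + 1) T r) (Function.update s i a) ↔
        φ.Realize (cliqueGlue k T r) (Function.update t i b)) := by
      intro a
      rcases hφ.2 with hlt | ⟨h0, hle⟩
      · obtain ⟨b, hb, hb'⟩ := h.exists_response_of_unused (exists_unused_of_card_lt t hlt) a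
        exact ⟨b, ih hφ.1 _ _ (SameType.update h hb hb')⟩
      · obtain ⟨b, hb, hb'⟩ := h.exists_response_of_card_le hle T r a
        exact ⟨b, realize_iff_of_depth_eq_zero φ h0 (PartialIso.update (h.partialIso T r) hb hb')⟩
    have back : ∀ b, ∃ a, (φ.Realize (cliqueGlue (k + 1) T r) (Function.update s i a) ↔
        φ.Realize (cliqueGlue k T r) (Function.update t i b)) := by
      intro b
      have hlt : (φ.freeVars.erase i).card < k + 1 := by
        have := hφ.2
        omega
      obtain ⟨a, ha, ha'⟩ := h.symm.exists_response_of_unused (exists_unused_of_card_lt s hlt) b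
      exact ⟨a, ih hφ.1 _ _ (SameType.update h (fun j hj => (ha j hj).symm)
        fun c => (ha' c).symm)⟩
    first
    | exact ⟨fun ⟨a, ha⟩ => (forth a).imp fun b hb => hb.1 ha,
        fun ⟨b, hb⟩ => (back b).imp fun a ha => ha.2 hb⟩
    | exact ⟨fun H b => (back b).elim fun a ha => ha.1 (H a),
        fun H a => (forth a).elim fun b hb => hb.2 (H b)⟩

theorem trueOn_cliqueGlue_succ_iff {B : Type*} {k : ℕ} (T : SimpleGraph B) (r : B)
    {φ : GraphFormula} (hs : φ.IsSentence) (hφ : φ.PebbleBound k) :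
    φ.TrueOn (cliqueGlue (k + 1) T r) ↔ φ.TrueOn (cliqueGlue k T r) := by
  have key : ∀ s t, (φ.Realize (cliqueGlue (k + 1) T r) s ↔ φ.Realize (cliqueGlue k T r) t) := by
    intro s t
    refine realize_cliqueGlue_succ_iff T r φ hφ s t ?_
    rw [IsSentence] at hs
    rw [hs]
    exact ⟨by simp, by simp⟩
  exact ⟨fun h t => (key (fun _ => .inr r) t).1 (h _),
    fun h s => (key s fun _ => .inr r).2 (h _)⟩

theorem IsSentence.depth_pos {φ : GraphFormula} (h : φ.IsSentence) : 0 < φ.depth := by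
  suffices ∀ ψ : GraphFormula, ψ.depth = 0 → ψ.freeVars.Nonempty by
    by_contra h0
    have := this φ (by omega)
    rw [h] at this
    simp at this
  intro ψ hψ
  induction ψ with
  | adj i j => exact ⟨i, by simp [freeVars]⟩
  | equal i j => exact ⟨i, by simp [freeVars]⟩
  | neg ψ ih => exact ih hψ
  | conj ψ χ ih _ | disj ψ χ ih _ =>
    simp only [depth, Nat.max_eq_zero_iff] at hψ
    exact (ih hψ.1).mono Finset.subset_union_left
  | ex i ψ | all i ψ => simp [depth] at hψ

/-- If `F` embeds in the connected graphs `T N` with a clique at the root only when this clique has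
more than half as many vertices as `F`, then every sentence defining the existence of `F` is large:
it must distinguish the least clique size that admits `F` from the size below. -/
theorem DefinesSubgraph.card_le {U : Type*} [Fintype U] {F : SimpleGraph U}
    {φ : GraphFormula} (hφ : φ.DefinesSubgraph F) (hU : 2 ≤ Fintype.card U)
    (T : ∀ N : ℕ, SimpleGraph (Fin (N + 1))) (hT : ∀ N, (T N).Connected)
    (hF : ∀ N k, F.IsContained (cliqueGlue k (T N) 0) → Fintype.card U ≤ 2 * k + 1) :
    Fintype.card U + 1 ≤ 2 * φ.depth ∧ Fintype.card U ≤ 2 * φ.width + 1 := by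
  classical
  obtain ⟨N, hs, hN⟩ := hφ
  have hex : ∃ k, F.IsContained (cliqueGlue k (T N) 0) := ⟨_, isContained_cliqueGlue_card F _ _⟩
  obtain ⟨k, hk, hmin⟩ : ∃ k, F.IsContained (cliqueGlue k (T N) 0) ∧
      ∀ m < k, ¬ F.IsContained (cliqueGlue m (T N) 0) :=
    ⟨Nat.find hex, Nat.find_spec hex, fun m hm => Nat.find_min hex hm⟩
  have hcard := hF N k hk
  obtain ⟨m, rfl⟩ : ∃ m, k = m + 1 := ⟨k - 1, by omega⟩
  have hb : ¬ φ.PebbleBound m := by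
    intro hb
    have h1 := (hN _ (cliqueGlue (m + 1) (T N) 0) (cliqueGlue_connected (hT N))
      (by simp; omega)).2 hk
    rw [trueOn_cliqueGlue_succ_iff _ _ hs hb] at h1
    exact hmin m (by omega) ((hN _ (cliqueGlue m (T N) 0) (cliqueGlue_connected (hT N))
      (by simp; omega)).1 h1)
  constructor
  · by_contra hlt
    refine hb (pebbleBound_of_depth_le φ ?_)
    rw [hs]
    simp
    omega
  · by_contra hlt
    exact hb (pebbleBound_of_width_le φ (by omega))

end GraphFormula

/-! ### Embeddings into cliques with a star or a path at the root -/

theorem SimpleGraph.Connected.mem_of_forall_adj {U : Type*} {F : SimpleGraph U}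
    (hF : F.Connected) {S : Set U} {u : U} (hu : u ∈ S)
    (hS : ∀ x ∈ S, ∀ y, F.Adj x y → y ∈ S) (w : U) : w ∈ S := by
  obtain ⟨p⟩ := hF.preconnected u w
  induction p with
  | nil => exact hu
  | cons h p ih => exact ih (hS _ hu _ h)

/-- At most `k + 1` vertices are mapped to the clique, including the root. -/
theorem card_le_card_add_succ {U B : Type*} [Fintype U] [DecidableEq U] {k : ℕ} {r : B}
    {f : U → Fin k ⊕ B} (hf : Function.Injective f) (P : Finset U)
    (hP : ∀ u, (∃ b ≠ r, f u = .inr b) → u ∈ P) : Fintype.card U ≤ P.card + (k + 1) := by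
  classical
  have h : Pᶜ.card ≤ k + 1 := by
    have hsub : Pᶜ.image f ⊆ insert (.inr r) (Finset.univ.image Sum.inl) := by
      intro z hz
      obtain ⟨u, hu, rfl⟩ := Finset.mem_image.1 hz
      rcases hfu : f u with i | b
      · simp
      · by_cases hb : b = r
        · simp [hb]
        · exact absurd (hP u ⟨b, hb, hfu⟩) (Finset.mem_compl.1 hu)
    have h1 := Finset.card_le_card hsub
    rw [Finset.card_image_of_injective _ hf] at h1
    have h2 := Finset.card_insert_le (Sum.inr r : Fin k ⊕ B) (Finset.univ.image Sum.inl)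
    rw [Finset.card_image_of_injective _ Sum.inl_injective, Finset.card_fin] at h2
    omega
  have := Finset.card_add_card_compl P
  omega

theorem nonempty_iso_pathGraph_two {U : Type*} [Fintype U] {F : SimpleGraph U}
    (hF : F.Connected) (hU : Fintype.card U = 2) : Nonempty (F ≃g pathGraph 2) := by
  classical
  have hadj : ∀ a b : U, a ≠ b → F.Adj a b := by
    intro a b hab
    have : Nontrivial U := ⟨a, b, hab⟩
    obtain ⟨c, hc⟩ := hF.preconnected.exists_adj_of_nontrivial a
    have hbc : b = c := by
      by_contra hbc
      have h3 : ({a, b, c} : Finset U).card = 3 :=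
        Finset.card_eq_three.2 ⟨a, b, c, hab, hc.ne, hbc, rfl⟩
      have := Finset.card_le_univ ({a, b, c} : Finset U)
      omega
    exact hbc ▸ hc
  refine ⟨⟨Fintype.equivFinOfCardEq hU, fun {a b} => ?_⟩⟩
  have h1 : (pathGraph 2).Adj (Fintype.equivFinOfCardEq hU a) (Fintype.equivFinOfCardEq hU b) ↔
      Fintype.equivFinOfCardEq hU a ≠ Fintype.equivFinOfCardEq hU b := by
    rw [pathGraph_two_eq_top, top_adj]
  exact h1.trans ⟨fun h => hadj a b fun e => h (by rw [e]),
    fun h e => h.ne ((Fintype.equivFinOfCardEq hU).injective e)⟩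

theorem nonempty_iso_pathGraph_three_of_adj {U : Type*} {F : SimpleGraph U} {a v b : U}
    (hav : F.Adj a v) (hbv : F.Adj b v) (hab : a ≠ b) (ha : ∀ x, F.Adj a x → x = v)
    (hcov : ∀ x, x = a ∨ x = v ∨ x = b) : Nonempty (F ≃g pathGraph 3) := by
  have hab' : ¬ F.Adj a b := fun h => hbv.ne (ha b h)
  have hinj : Function.Injective ![a, v, b] := by
    intro i j
    fin_cases i <;> fin_cases j <;> simp [hav.ne, hav.ne', hbv.ne, hbv.ne', hab, hab.symm]
  have hsurj : Function.Surjective ![a, v, b] := by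
    intro x
    rcases hcov x with rfl | rfl | rfl
    exacts [⟨0, rfl⟩, ⟨1, rfl⟩, ⟨2, rfl⟩]
  refine ⟨(⟨Equiv.ofBijective _ ⟨hinj, hsurj⟩, fun {i j} => ?_⟩ : pathGraph 3 ≃g F).symm⟩
  have hab'' : ¬ F.Adj b a := fun h => hab' h.symm
  change F.Adj (![a, v, b] i) (![a, v, b] j) ↔ _
  fin_cases i <;> fin_cases j <;>
    simp [pathGraph_adj, hav, hav.symm, hbv, hbv.symm, hab', hab'']

/-- The three-vertex path is the only connected graph on at least three vertices in which at least
half of the vertices can be leaves on a star, and at least half can lie on a path attached by one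
end. -/
theorem nonempty_iso_pathGraph_three {U : Type*} [Fintype U] {F : SimpleGraph U}
    (hF : F.Connected) (hU : 3 ≤ Fintype.card U) {k l M N : ℕ}
    (hstar : F.IsContained (cliqueGlue k (starGraph (0 : Fin (M + 1))) 0))
    (hk : 2 * k + 2 ≤ Fintype.card U)
    (hpath : F.IsContained (cliqueGlue l (pathGraph (N + 1)) 0))
    (hl : 2 * l + 2 ≤ Fintype.card U) : Nonempty (F ≃g pathGraph 3) := by
  classical
  obtain ⟨f⟩ := hstar
  obtain ⟨g⟩ := hpath
  let S : Finset U := Finset.univ.filter fun u => ∃ b, b ≠ 0 ∧ f u = .inr b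
  let P : Finset U := Finset.univ.filter fun u => ∃ b, b ≠ 0 ∧ g u = .inr b
  have hS : Fintype.card U ≤ S.card + (k + 1) :=
    card_le_card_add_succ f.injective S fun u hu => by simpa [S] using hu
  have hP : Fintype.card U ≤ P.card + (l + 1) :=
    card_le_card_add_succ g.injective P fun u hu => by simpa [P] using hu
  -- A leaf of the star is adjacent to its centre only.
  have hSadj : ∀ u ∈ S, ∀ x, F.Adj u x → f x = .inr 0 := by
    intro u hu x hux
    obtain ⟨b, hb, hfu⟩ := (Finset.mem_filter.1 hu).2
    have h := f.toHom.map_adj hux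
    change (cliqueGlue k (starGraph (0 : Fin (M + 1))) 0).Adj (f u) (f x) at h
    rw [hfu] at h
    rcases hfx : f x with i | c <;> rw [hfx] at h
    · exact absurd h hb
    · rw [cliqueGlue_adj_inr_inr, starGraph_adj] at h
      rw [h.2.resolve_left hb]
  obtain ⟨a, haS, b, hbS, hab⟩ := Finset.one_lt_card.1 (show 1 < S.card by omega)
  have : Nontrivial U := ⟨a, b, hab⟩
  obtain ⟨v, hav⟩ := hF.preconnected.exists_adj_of_nontrivial a
  have hv := hSadj a haS v hav
  have hSv : ∀ u ∈ S, ∀ x, F.Adj u x → x = v := fun u hu x hux =>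
    f.injective ((hSadj u hu x hux).trans hv.symm)
  have hSv' : ∀ u ∈ S, F.Adj u v := fun u hu => by
    obtain ⟨x, hx⟩ := hF.preconnected.exists_adj_of_nontrivial u
    exact hSv u hu x hx ▸ hx
  -- A vertex on the path off the root is adjacent to its predecessor and its successor only.
  have hPadj : ∀ u c, c ≠ 0 → g u = .inr c → ∀ x, F.Adj u x →
      ∃ d, g x = .inr d ∧ (c.val + 1 = d.val ∨ d.val + 1 = c.val) := by
    intro u c hc hgu x hux
    have h := g.toHom.map_adj hux
    change (cliqueGlue l (pathGraph (N + 1)) 0).Adj (g u) (g x) at h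
    rw [hgu] at h
    rcases hgx : g x with i | d <;> rw [hgx] at h
    · exact absurd h hc
    · rw [cliqueGlue_adj_inr_inr, pathGraph_adj] at h
      exact ⟨d, rfl, h⟩
  have hginj : ∀ {x y : U} {c d : Fin (N + 1)}, g x = .inr c → g y = .inr d → c.val = d.val →
      x = y := fun hx hy h => g.injective (hx.trans ((congrArg _ (Fin.ext h)).trans hy.symm))
  by_cases hvP : v ∈ P
  · -- The neighbours of `v` are its predecessor and successor, so they are `a` and `b`.
    obtain ⟨c, hc, hgv⟩ := (Finset.mem_filter.1 hvP).2
    obtain ⟨da, hda, hda'⟩ := hPadj v c hc hgv a hav.symm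
    obtain ⟨db, hdb, hdb'⟩ := hPadj v c hc hgv b (hSv' b hbS).symm
    have hdab : da.val ≠ db.val := fun e => hab (hginj hda hdb e)
    have hN : ∀ x, F.Adj v x → x = a ∨ x = b := by
      intro x hx
      obtain ⟨d, hd, hd'⟩ := hPadj v c hc hgv x hx
      have : d.val = da.val ∨ d.val = db.val := by omega
      rcases this with e | e
      · exact .inl (hginj hd hda e)
      · exact .inr (hginj hd hdb e)
    refine nonempty_iso_pathGraph_three_of_adj hav (hSv' b hbS) hab (hSv a haS) fun w => ?_
    refine hF.mem_of_forall_adj (S := {x | x = a ∨ x = v ∨ x = b}) (u := v) (by simp) ?_ w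
    rintro x (rfl | rfl | rfl) y hxy
    · exact .inr (.inl (hSv _ haS y hxy))
    · exact (hN y hxy).imp id .inr
    · exact .inr (.inl (hSv _ hbS y hxy))
  · -- By counting, a leaf `u` at `v` lies on the path, with `v` as the root and `u` next to it.
    have hvS : v ∉ S := fun h => (hSv' v h).ne rfl
    obtain ⟨u, huS, huP⟩ : ∃ u ∈ S, u ∈ P := by
      by_contra! hdis
      have hd : Disjoint (insert v S) P := by
        rw [Finset.disjoint_left]
        intro x hx
        rcases Finset.mem_insert.1 hx with rfl | hx
        exacts [hvP, hdis x hx]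
      have h1 := Finset.card_le_univ (insert v S ∪ P)
      rw [Finset.card_union_of_disjoint hd, Finset.card_insert_of_notMem hvS] at h1
      omega
    obtain ⟨c, hc, hgu⟩ := (Finset.mem_filter.1 huP).2
    obtain ⟨d, hgv, hcd⟩ := hPadj u c hc hgu v (hSv' u huS)
    have hd0 : d = 0 := by
      by_contra hd0
      exact hvP (Finset.mem_filter.2 ⟨Finset.mem_univ _, d, hd0, hgv⟩)
    subst hd0
    have hc1 : c.val = 1 := by simpa [eq_comm] using hcd
    obtain ⟨w, hwP, hwu⟩ := Finset.exists_mem_ne (show 1 < P.card by omega) u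
    obtain ⟨e, he, hgw⟩ := (Finset.mem_filter.1 hwP).2
    -- The vertices beyond `u` on the path can only be reached through `u`, which is a leaf.
    have hclosed := hF.mem_of_forall_adj (S := {x | ∃ e : Fin (N + 1), 2 ≤ e.val ∧ g x = .inr e})
      (u := w) ⟨e, ?_, hgw⟩ ?_ v
    · obtain ⟨e', he', hgv'⟩ := hclosed
      rw [hgv] at hgv'
      rw [← Sum.inr_injective hgv'] at he'
      simp at he'
    · have h0 : e.val ≠ 0 := fun h => he (Fin.ext h)
      have h1 : e.val ≠ 1 := fun h => hwu (hginj hgw hgu (h.trans hc1.symm))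
      omega
    · rintro x ⟨e, he2, hgx⟩ y hxy
      obtain ⟨e', hgy, hee⟩ := hPadj x e (fun h => by simp [h] at he2) hgx y hxy
      refine ⟨e', ?_, hgy⟩
      by_contra hlt
      have hyu : y = u := hginj hgy hgu (by omega)
      have hxv : x = v := hSv u huS x (hyu ▸ hxy.symm)
      rw [hxv, hgv] at hgx
      rw [← Sum.inr_injective hgx] at he2
      simp at he2

namespace GraphFormula

theorem DefinesSubgraph.card_le_of_connected {U : Type*} [Fintype U] {F : SimpleGraph U}
    (hF : F.Connected) (h₂ : IsEmpty (F ≃g pathGraph 2)) (h₃ : IsEmpty (F ≃g pathGraph 3))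
    {φ : GraphFormula} (hφ : φ.DefinesSubgraph F) :
    Fintype.card U + 1 ≤ 2 * φ.depth ∧ Fintype.card U ≤ 2 * φ.width + 1 := by
  have hne2 : Fintype.card U ≠ 2 := fun h =>
    not_isEmpty_iff.2 (nonempty_iso_pathGraph_two hF h) h₂
  by_cases hU : 3 ≤ Fintype.card U
  · by_cases hstar : ∀ N k, F.IsContained (cliqueGlue k (starGraph (0 : Fin (N + 1))) 0) →
        Fintype.card U ≤ 2 * k + 1
    · exact hφ.card_le (by omega) (fun N => starGraph (0 : Fin (N + 1)))
        (fun N => connected_starGraph _) hstar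
    · push Not at hstar
      obtain ⟨M, k, hk, hk'⟩ := hstar
      refine hφ.card_le (by omega) (fun N => pathGraph (N + 1))
        (fun N => pathGraph_connected N) fun N l hl => ?_
      by_contra hlt
      exact not_isEmpty_iff.2
        (nonempty_iso_pathGraph_three hF hU hk (by omega) hl (by omega)) h₃
  · obtain ⟨-, hs, -⟩ := hφ
    have := hs.depth_pos
    omega

end GraphFormula

theorem theorem3p4 {U : Type*} [Fintype U] (F : SimpleGraph U) (hF : F.Connected)
    (h₂ : IsEmpty (F ≃g SimpleGraph.pathGraph 2))
    (h₃ : IsEmpty (F ≃g SimpleGraph.pathGraph 3)) :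
    ((Fintype.card U : ℝ) + 1) / 2 ≤ (subgraphDepth F : ℝ) ∧
      ((Fintype.card U : ℝ) - 1) / 2 ≤ (subgraphWidth F : ℝ) := by
  have := hF.nonempty
  obtain ⟨φ₀, h₀⟩ := GraphFormula.exists_definesSubgraph F
  constructor
  · obtain ⟨φ, hφ, hd⟩ := Nat.sInf_mem
      (s := {d : ℕ | ∃ φ : GraphFormula, φ.DefinesSubgraph F ∧ φ.depth = d}) ⟨_, φ₀, h₀, rfl⟩
    have h := (hφ.card_le_of_connected hF h₂ h₃).1
    rw [hd] at h
    have h' : (Fintype.card U : ℝ) + 1 ≤ 2 * (subgraphDepth F : ℝ) := by exact_mod_cast h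
    linarith
  · obtain ⟨φ, hφ, hd⟩ := Nat.sInf_mem
      (s := {w : ℕ | ∃ φ : GraphFormula, φ.DefinesSubgraph F ∧ φ.width = w}) ⟨_, φ₀, h₀, rfl⟩
    have h := (hφ.card_le_of_connected hF h₂ h₃).2
    rw [hd] at h
    have h' : (Fintype.card U : ℝ) ≤ 2 * (subgraphWidth F : ℝ) + 1 := by exact_mod_cast h
    linarith
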